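/- Let $N\ge 1$, $0<s<1$, $\frac N2<\mu<N+2s$, $R>0$ and $m>0$. For a real function $u\in L^2(\mathbb R^N)$ write $u\in H^{2s}(\mathbb R^N)$ if $\int_{\mathbb R^N}(1+|\xi|^{4s})|\hat u(\xi)|^2\,d\xi<\infty$, and then let $(-\Delta)^s u\in L^2(\mathbb R^N)$ be the function with $\widehat{(-\Delta)^s u}(\xi)=|\xi|^{2s}\hat u(\xi)$, where $\hat u(\xi)=(2\pi)^{-N/2}\int_{\mathbb R^N} e^{-ix\cdot\xi}u(x)\,dx$, extended to $L^2(\mathbb R^N)$ as usual. There is a constant $C>0$, depending only on $N,s,\mu,R,m$, such that the following holds. Let $k\ge 1$, let $q_1,\dots,q_k\in\mathbb R^N$, let $B=\bigcup_{j=1}^k B_R(q_j)$ be the union of the open balls of radius $R$ about these points, and put $$\rho(x)=\sum_{j=1}^k\frac{1}{(1+|x-q_j|)^{\mu}}.$$ Let $W:\mathbb R^N\to\mathbb R$ be continuous with $W(x)\ge m$ for all $x\in\mathbb R^N\setminus B$. Let $g:\mathbb R^N\to\mathbb R$ satisfy $\|\rho^{-1}g\|_{L^\infty(\mathbb R^N)}<\infty$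 and let $\varphi\in H^{2s}(\mathbb R^N)\cap L^\infty(\mathbb R^N)$ be a real function with $$(-\Delta)^s\varphi+W\varphi=g\quad\text{almost everywhere in }\mathbb R^N.$$ Then $$\|\rho^{-1}\varphi\|_{L^\infty(\mathbb R^N)}\le C\left(\|\varphi\|_{L^\infty(B)}+\|\rho^{-1}g\|_{L^\infty(\mathbb R^N)}\right).$$ In particular $C$ does not depend on $k$, on the points $q_j$, or on $W$ other than through the lower bound $m$. -/

import Mathlib

open MeasureTheory FourierTransform
open scoped ENNReal

noncomputable section

namespace FracSchrodinger

/-- The space `ℝ^N` with its Euclidean norm. -/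
abbrev Space (N : ℕ) : Type := EuclideanSpace ℝ (Fin N)

/-- The class in `L²(ℝ^N; ℂ)` of a square integrable real function. -/
def toL2 {N : ℕ} (u : Space N → ℝ) (hu : MemLp u 2 volume) :
    Lp (α := Space N) ℂ 2 volume :=
  (hu.ofReal (K := ℂ)).toLp (fun x => (u x : ℂ))

/-- `u ∈ H^σ(ℝ^N)`: `u` is square integrable and `∫ (1 + |ξ|^{2σ}) |û(ξ)|² dξ < ∞`. -/
def MemH {N : ℕ} (σ : ℝ) (u : Space N → ℝ) : Prop :=
  ∃ hu : MemLp u 2 volume,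
    ∫⁻ ξ : Space N, ENNReal.ofReal (1 + ‖ξ‖ ^ (2 * σ)) * ‖(𝓕 (toL2 u hu)) ξ‖ₑ ^ 2 < ∞

/-- `f = (-Δ)^s u` for square integrable `u` and `f`. Mathlib's Fourier transform is
`û(ξ) = ∫ exp(-2πi x·ξ) u(x) dx`, for which `-Δ` has the symbol `(2π|ξ|)²`, so that `(-Δ)^s`
has the symbol `(2π|ξ|)^{2s}`. -/
def IsFracLaplacian {N : ℕ} (s : ℝ) (u : Space N → ℝ) (f : Space N → ℝ) : Prop :=
  ∃ (hu : MemLp u 2 volume) (hf : MemLp f 2 volume),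
    ∀ᵐ ξ : Space N,
      (𝓕 (toL2 f hf)) ξ = (((2 * Real.pi * ‖ξ‖) ^ (2 * s) : ℝ) : ℂ) * (𝓕 (toL2 u hu)) ξ

/-- `u` solves `(-Δ)^s u + W u = g` in `ℝ^N` (an identity of functions up to null sets). -/
def SolvesEq {N : ℕ} (s : ℝ) (W u g : Space N → ℝ) : Prop :=
  ∃ f : Space N → ℝ, IsFracLaplacian s u f ∧ ∀ᵐ x : Space N, f x + W x * u x = g x

/-- The weight `ρ(x) = ∑_j (1 + |x - q_j|)^{-μ}`. -/
def weight {N k : ℕ} (μ : ℝ) (q : Fin k → Space N) (x : Space N) : ℝ :=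
  ∑ j, 1 / (1 + ‖x - q j‖) ^ μ

/-- The union `B` of the balls `B_R(q_j)`. -/
def ballUnion {N k : ℕ} (R : ℝ) (q : Fin k → Space N) : Set (Space N) :=
  ⋃ j, Metric.ball (q j) R

/-- The (essential) sup norm `‖f‖_{L^∞(A)}`, with value `∞` if `f` is unbounded on `A`. -/
def linftyNorm {N : ℕ} (f : Space N → ℝ) (A : Set (Space N)) : ℝ≥0∞ :=
  eLpNorm f ∞ (volume.restrict A)

end FracSchrodinger

end

noncomputable section

namespace FracSchrodinger

/-! The function `φ` is compared with the barrier `ψ(x) = ∑_j (1 + δ²|x - q_j|²)^{-μ/2}`, which lies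
between `ρ` and `(δ/2)^{-μ} ρ`. For one profile, the positive part of the second differences,
integrated against `|y|^{-(N+2s)}`, is at most a constant times the profile: small `y` contribute
`O(|y|²)`, and for large `y` the condition `μ < N + 2s` makes the kernel decay faster than the
profile. Dilation by `δ` multiplies that constant by `δ^{2s}`, so a small `δ` brings it below the
level set by `m/2` (`exists_lintegral_profile_smul_second_difference_le`). The bound adds up over
`j`, so `δ` depends neither on `k` nor on the points.

Let `A = ‖φ‖_{L^∞(B)}`, `D = ‖ρ⁻¹g‖_∞` and `K = A(1+R)^μ + 2D/m`. Then `φ > Kψ` is possible only off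
`B`, where `W ≥ m`, and there `(-Δ)^s φ + mφ ≤ (m/2)Kψ`. Testing with `w = (φ - Kψ)₊` yields `m ∫ w²
≤ 0` (`ae_le_mul_barrier`). The same argument for `-φ` gives the lower bound.

The test never applies `(-Δ)^s` to `ψ`. Plancherel and the formula for the symbol write `c ∫ w
(-Δ)^s φ` as an integral over `y` of second differences of `φ` paired with `w`
(`integral_differencePairing_mul_levyKernel`). For each fixed `y` the pairing of `φ - Kψ` with its
positive part is nonnegative (`differencePairing_posPart_nonneg`), so `φ` may be replaced by `Kψ`;
Tonelli then brings in the pointwise barrier bound. This needs `ψ ∈ L²`, which is where `μ > N/2`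
enters. -/

/-! ### The Lévy kernel and the symbol `|ξ|^{2s}`. -/

/-- The Lévy kernel `|y|^{-(N+2s)}` of the fractional Laplacian. -/
def levyKernel {N : ℕ} (s : ℝ) (y : Space N) : ℝ := ‖y‖ ^ (-((N : ℝ) + 2 * s))

lemma levyKernel_nonneg {N : ℕ} (s : ℝ) (y : Space N) : 0 ≤ levyKernel s y := by
  unfold levyKernel; positivity

lemma measurable_levyKernel {N : ℕ} (s : ℝ) : Measurable (levyKernel s : Space N → ℝ) := by
  unfold levyKernel; fun_prop

lemma levyKernel_smul {N : ℕ} (s : ℝ) {r : ℝ} (hr : 0 < r) (y : Space N) :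
    levyKernel s (r • y) = r ^ (-((N : ℝ) + 2 * s)) * levyKernel s y := by
  unfold levyKernel
  rw [norm_smul, Real.norm_of_nonneg hr.le, Real.mul_rpow hr.le (norm_nonneg _)]

/-- In polar coordinates the integrand is `r^{1-2s}` on `(0,1]`, integrable as `s < 1`, and
`r^{-1-2s}` beyond, integrable as `s > 0`. -/
lemma integrable_min_sq_mul_levyKernel {N : ℕ} (hN : 1 ≤ N) {s : ℝ} (hs : 0 < s) (hs' : s < 1) :
    Integrable (fun y : Space N => min (‖y‖ ^ 2) 1 * levyKernel s y) := by
  have : Nonempty (Fin N) := ⟨⟨0, hN⟩⟩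
  have key := integrable_fun_norm_addHaar (μ := (volume : Measure (Space N)))
    (f := fun r : ℝ => min (r ^ 2) 1 * r ^ (-((N : ℝ) + 2 * s)))
  refine key.2 ?_
  rw [finrank_euclideanSpace_fin, ← Set.Ioc_union_Ioi_eq_Ioi zero_le_one]
  refine IntegrableOn.union ?_ ?_
  · have h : IntegrableOn (fun r : ℝ => r ^ (1 - 2 * s)) (Set.Ioc 0 1) := by
      rw [← intervalIntegrable_iff_integrableOn_Ioc_of_le zero_le_one]
      exact intervalIntegral.intervalIntegrable_rpow' (by linarith)
    refine h.congr_fun (fun r hr => ?_) measurableSet_Ioc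
    have hr0 : 0 < r := hr.1
    have h1 : min (r ^ 2) 1 = r ^ 2 := min_eq_left (by nlinarith [hr.1, hr.2])
    simp only [smul_eq_mul, h1]
    rw [← Real.rpow_natCast r (N - 1), ← Real.rpow_natCast r 2, ← Real.rpow_add hr0,
      ← Real.rpow_add hr0, Nat.cast_sub hN]
    congr 1
    push_cast
    ring
  · have h : IntegrableOn (fun r : ℝ => r ^ (-1 - 2 * s)) (Set.Ioi 1) :=
      integrableOn_Ioi_rpow_of_lt (by linarith) one_pos
    refine h.congr_fun (fun r hr => ?_) measurableSet_Ioi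
    have hr1 : 1 < r := hr
    have hr0 : 0 < r := one_pos.trans hr1
    have h1 : min (r ^ 2) 1 = 1 := min_eq_right (by nlinarith)
    simp only [smul_eq_mul, h1]
    rw [one_mul, ← Real.rpow_natCast r (N - 1), ← Real.rpow_add hr0, Nat.cast_sub hN]
    congr 1
    push_cast
    ring

/-- The difference symbol `2 (1 - cos ⟨y, ξ⟩)`. -/
def cosSymbol {N : ℕ} (y ξ : Space N) : ℝ := 2 * (1 - Real.cos (inner ℝ y ξ))

lemma cosSymbol_nonneg {N : ℕ} (y ξ : Space N) : 0 ≤ cosSymbol y ξ := by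
  have := Real.cos_le_one (inner ℝ y ξ)
  unfold cosSymbol; linarith

lemma cosSymbol_le {N : ℕ} (y ξ : Space N) :
    cosSymbol y ξ ≤ (‖ξ‖ ^ 2 + 4) * min (‖y‖ ^ 2) 1 := by
  have h1 := Real.one_sub_sq_div_two_le_cos (x := inner ℝ y ξ)
  have h2 := Real.neg_one_le_cos (inner ℝ y ξ)
  have h3 : (inner ℝ y ξ) ^ 2 ≤ ‖ξ‖ ^ 2 * ‖y‖ ^ 2 := by
    rw [← sq_abs, ← mul_pow, mul_comm ‖ξ‖]
    exact pow_le_pow_left₀ (abs_nonneg _) (abs_real_inner_le_norm y ξ) 2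
  unfold cosSymbol
  rcases min_cases (‖y‖ ^ 2) 1 with h | h <;> rw [h.1] <;>
    nlinarith [sq_nonneg ‖ξ‖, sq_nonneg ‖y‖]

lemma continuous_cosSymbol {N : ℕ} :
    Continuous (fun p : Space N × Space N => cosSymbol p.1 p.2) := by
  unfold cosSymbol; fun_prop

lemma integrable_cosSymbol_mul_levyKernel {N : ℕ} (hN : 1 ≤ N) {s : ℝ} (hs : 0 < s) (hs' : s < 1)
    (ξ : Space N) : Integrable (fun y : Space N => cosSymbol y ξ * levyKernel s y) := by
  refine ((integrable_min_sq_mul_levyKernel hN hs hs').const_mul (‖ξ‖ ^ 2 + 4)).mono' ?_ ?_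
  · have h : Measurable (fun y : Space N => cosSymbol y ξ) :=
      (continuous_cosSymbol.comp (Continuous.prodMk_left ξ)).measurable
    exact (h.mul (measurable_levyKernel s)).aestronglyMeasurable
  · refine Filter.Eventually.of_forall fun y => ?_
    rw [Real.norm_of_nonneg (mul_nonneg (cosSymbol_nonneg _ _) (levyKernel_nonneg _ _)),
      ← mul_assoc]
    exact mul_le_mul_of_nonneg_right (cosSymbol_le y ξ) (levyKernel_nonneg _ _)

/-- The reflection in the hyperplane orthogonal to `ξ - η` sends `ξ` to `η` and preserves both the
kernel and Lebesgue measure. -/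
lemma integral_cosSymbol_eq_of_norm_eq {N : ℕ} (s : ℝ) {ξ η : Space N} (h : ‖ξ‖ = ‖η‖) :
    ∫ y : Space N, cosSymbol y ξ * levyKernel s y =
      ∫ y : Space N, cosSymbol y η * levyKernel s y := by
  set T := (Submodule.span ℝ {ξ - η})ᗮ.reflection with hT
  have hTξ : T ξ = η := Submodule.reflection_sub h
  rw [← T.measurePreserving.integral_comp' (f := T.toMeasurableEquiv)
    (fun y => cosSymbol y η * levyKernel s y)]
  refine integral_congr_ae (Filter.Eventually.of_forall fun y => ?_)
  have h1 : inner ℝ (T y) η = inner ℝ y ξ := by rw [← hTξ, T.inner_map_map]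
  have h2 : ‖T y‖ = ‖y‖ := T.norm_map y
  show cosSymbol y ξ * levyKernel s y = cosSymbol (T y) η * levyKernel s (T y)
  simp only [cosSymbol, levyKernel, h1, h2]

lemma integral_cosSymbol_smul {N : ℕ} (s : ℝ) {r : ℝ} (hr : 0 < r) (ξ : Space N) :
    ∫ y : Space N, cosSymbol y (r • ξ) * levyKernel s y =
      r ^ (2 * s) * ∫ y : Space N, cosSymbol y ξ * levyKernel s y := by
  have h := Measure.integral_comp_smul_of_nonneg (volume : Measure (Space N))
    (fun y => cosSymbol y ξ * levyKernel s y) r (hR := hr.le)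
  have h2 : ∀ y : Space N, cosSymbol (r • y) ξ * levyKernel s (r • y) =
      r ^ (-((N : ℝ) + 2 * s)) * (cosSymbol y (r • ξ) * levyKernel s y) := by
    intro y
    rw [levyKernel_smul s hr]
    simp only [cosSymbol, inner_smul_left, inner_smul_right, conj_trivial]
    ring
  simp only [h2, integral_const_mul, finrank_euclideanSpace_fin, smul_eq_mul] at h
  have h3 : r ^ ((N : ℝ) + 2 * s) * r ^ (-((N : ℝ) + 2 * s)) = 1 := by
    rw [← Real.rpow_add hr]; simp
  have h4 : r ^ ((N : ℝ) + 2 * s) * (r ^ N)⁻¹ = r ^ (2 * s) := by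
    rw [Real.rpow_add hr, Real.rpow_natCast]
    field_simp
  rw [← h4, mul_assoc, ← h, ← mul_assoc, h3, one_mul]

/-- The integral is radial in `ξ` and homogeneous of degree `2s`, so it is determined by its value
`c` at a unit vector. -/
theorem exists_integral_cosSymbol_eq {N : ℕ} (hN : 1 ≤ N) {s : ℝ} (hs : 0 < s) (hs' : s < 1) :
    ∃ c : ℝ, 0 < c ∧ ∀ ξ : Space N,
      ∫ y : Space N, cosSymbol y ξ * levyKernel s y = c * ‖ξ‖ ^ (2 * s) := by
  set e : Space N := EuclideanSpace.single ⟨0, hN⟩ 1 with he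
  have hne : ‖e‖ = 1 := by simp [he]
  refine ⟨∫ y : Space N, cosSymbol y e * levyKernel s y, ?_, fun ξ => ?_⟩
  · rw [integral_pos_iff_support_of_nonneg
      (fun y => mul_nonneg (cosSymbol_nonneg _ _) (levyKernel_nonneg _ _))
      (integrable_cosSymbol_mul_levyKernel hN hs hs' e)]
    -- The integrand is positive on the nonempty open strip `0 < ⟨y, e⟩ < 1`.
    have ho : IsOpen ((fun y : Space N => inner ℝ y e) ⁻¹' Set.Ioo 0 1) :=
      isOpen_Ioo.preimage (by fun_prop)
    refine (ho.measure_pos volume ⟨(1 / 2 : ℝ) • e, ?_⟩).trans_le (measure_mono ?_)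
    · simp [inner_smul_left, hne]; norm_num
    · intro y hy
      have hy0 : (0 : ℝ) < inner ℝ y e := hy.1
      have hy1 : inner ℝ y e < (1 : ℝ) := hy.2
      have hyn : y ≠ 0 := by rintro rfl; simp at hy0
      have hc : Real.cos (inner ℝ y e) < 1 := by
        rw [← Real.cos_zero]
        exact Real.cos_lt_cos_of_nonneg_of_le_pi le_rfl (by linarith [Real.pi_gt_three]) hy0
      have h1 : 0 < cosSymbol y e := by unfold cosSymbol; linarith
      have h2 : 0 < levyKernel s y := Real.rpow_pos_of_pos (norm_pos_iff.2 hyn) _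
      exact (mul_pos h1 h2).ne'
  · rcases eq_or_ne ξ 0 with rfl | hξ
    · have : (2 * s) ≠ 0 := by positivity
      simp [cosSymbol, Real.zero_rpow this]
    · have hξ0 : 0 < ‖ξ‖ := norm_pos_iff.2 hξ
      rw [mul_comm, ← integral_cosSymbol_smul s hξ0]
      exact integral_cosSymbol_eq_of_norm_eq s (by rw [norm_smul, hne]; simp)

/-! ### Elementary inequalities for negative powers. -/

lemma one_add_rpow_neg_le {a t : ℝ} (ha : 0 < a) (ht : |t| ≤ 1 / 2) :
    (1 + t) ^ (-a) ≤ Real.exp (2 * a * t ^ 2) * Real.exp (-(a * t)) := by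
  obtain ⟨h1, h2⟩ := abs_le.1 ht
  have hpos : 0 < 1 + t := by linarith
  have hlog : t - 2 * t ^ 2 ≤ Real.log (1 + t) := by
    refine le_trans ?_ (Real.one_sub_inv_le_log_of_pos hpos)
    have : 1 - (1 + t)⁻¹ - (t - 2 * t ^ 2) = t ^ 2 * (1 + 2 * t) / (1 + t) := by
      field_simp; ring
    have h3 : 0 ≤ t ^ 2 * (1 + 2 * t) / (1 + t) :=
      div_nonneg (mul_nonneg (sq_nonneg t) (by linarith)) hpos.le
    linarith
  rw [Real.rpow_def_of_pos hpos, ← Real.exp_add]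
  refine Real.exp_le_exp.2 ?_
  nlinarith

/-- Adding the exponential bounds for `t` and `-t` cancels the linear term through `cosh z ≤ exp
(z²/2)`, leaving `2 exp (M t²)`. -/
lemma exists_rpow_neg_second_difference_le {a : ℝ} (ha : 0 < a) :
    ∃ C : ℝ, 0 < C ∧ ∀ t : ℝ, |t| ≤ 1 / 2 →
      (1 + t) ^ (-a) + (1 - t) ^ (-a) ≤ 2 + C * t ^ 2 := by
  set M := 2 * a + a ^ 2 / 2 with hM
  have hM0 : 0 < M := by positivity
  refine ⟨2 * (M * Real.exp M), by positivity, fun t ht => ?_⟩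
  have ht2 : t ^ 2 ≤ 1 := by rw [← sq_abs]; nlinarith [abs_nonneg t]
  have h1 := one_add_rpow_neg_le ha ht
  have h2 := one_add_rpow_neg_le ha (t := -t) (by rwa [abs_neg])
  have h3 : Real.exp (-(a * t)) + Real.exp (-(a * -t)) ≤ 2 * Real.exp ((a * t) ^ 2 / 2) := by
    have := Real.cosh_le_exp_half_sq (a * t)
    rw [Real.cosh_eq] at this
    rw [mul_neg, neg_neg]
    linarith
  have h4 : (1 + t) ^ (-a) + (1 - t) ^ (-a) ≤ 2 * Real.exp (M * t ^ 2) := by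
    have h5 : Real.exp (M * t ^ 2) =
        Real.exp (2 * a * t ^ 2) * Real.exp ((a * t) ^ 2 / 2) := by
      rw [← Real.exp_add]; congr 1; rw [hM]; ring
    rw [neg_sq, ← sub_eq_add_neg] at h2
    rw [h5]
    nlinarith [Real.exp_pos (2 * a * t ^ 2)]
  -- This is `1 - z ≤ exp (-z)` multiplied by `exp z`, with `z = M t²`.
  have h6 : Real.exp (M * t ^ 2) ≤ 1 + M * t ^ 2 * Real.exp (M * t ^ 2) := by
    have h7 := Real.add_one_le_exp (-(M * t ^ 2))
    have h8 : Real.exp (-(M * t ^ 2)) * Real.exp (M * t ^ 2) = 1 := by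
      rw [← Real.exp_add]; simp
    nlinarith [Real.exp_pos (M * t ^ 2)]
  have h9 : Real.exp (M * t ^ 2) ≤ Real.exp M := Real.exp_le_exp.2 (by nlinarith)
  have h10 : M * t ^ 2 * Real.exp (M * t ^ 2) ≤ M * t ^ 2 * Real.exp M :=
    mul_le_mul_of_nonneg_left h9 (by positivity)
  linarith

/-- The larger of `X` and `Y` is at least `Z/2`, so its power `-μ` supplies `Z^{-μ}`. If that is
`Y`, the surplus `Y^{-(n-μ)}` is passed to `X`, which uses `μ ≤ n`. -/
lemma rpow_neg_mul_rpow_neg_le {X Y Z μ n : ℝ} (hX : 0 < X) (hY : 0 < Y) (hZ : 0 < Z)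
    (hZXY : Z ≤ X + Y) (hμ : 0 < μ) (hn : μ ≤ n) :
    X ^ (-μ) * Y ^ (-n) ≤ 2 ^ μ * Z ^ (-μ) * (X ^ (-n) + Y ^ (-n)) := by
  have hhalf : ∀ T : ℝ, 0 < T → Z ≤ 2 * T → T ^ (-μ) ≤ 2 ^ μ * Z ^ (-μ) := by
    intro T hT h
    have h1 : (2 * T) ^ (-μ) ≤ Z ^ (-μ) :=
      Real.rpow_le_rpow_of_nonpos hZ h (by linarith)
    rw [Real.mul_rpow two_pos.le hT.le] at h1
    have h2 : (2 : ℝ) ^ μ * 2 ^ (-μ) = 1 := by rw [← Real.rpow_add two_pos]; simp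
    calc T ^ (-μ) = 2 ^ μ * (2 ^ (-μ) * T ^ (-μ)) := by rw [← mul_assoc, h2, one_mul]
      _ ≤ _ := by gcongr
  have hXn : 0 < X ^ (-n) := Real.rpow_pos_of_pos hX _
  have hYn : 0 < Y ^ (-n) := Real.rpow_pos_of_pos hY _
  have hZc : 0 < 2 ^ μ * Z ^ (-μ) := by positivity
  rcases le_total X Y with h | h
  · have h1 : Y ^ (-n) = Y ^ (-μ) * Y ^ (-(n - μ)) := by
      rw [← Real.rpow_add hY]; congr 1; ring
    have h2 : X ^ (-n) = X ^ (-μ) * X ^ (-(n - μ)) := by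
      rw [← Real.rpow_add hX]; congr 1; ring
    have h3 : Y ^ (-(n - μ)) ≤ X ^ (-(n - μ)) :=
      Real.rpow_le_rpow_of_nonpos hX h (by linarith)
    have h4 := hhalf Y hY (by linarith)
    calc X ^ (-μ) * Y ^ (-n) = Y ^ (-μ) * (X ^ (-μ) * Y ^ (-(n - μ))) := by rw [h1]; ring
      _ ≤ (2 ^ μ * Z ^ (-μ)) * (X ^ (-μ) * X ^ (-(n - μ))) := by gcongr
      _ ≤ _ := by rw [← h2]; nlinarith
  · have h4 := hhalf X hX (by linarith)
    calc X ^ (-μ) * Y ^ (-n) ≤ (2 ^ μ * Z ^ (-μ)) * Y ^ (-n) := by gcongr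
      _ ≤ _ := by nlinarith

/-! ### The profile and its second differences. -/

/-- The smooth profile `(1 + |x|²)^{-μ/2}`. -/
def profile {N : ℕ} (μ : ℝ) (x : Space N) : ℝ := (1 + ‖x‖ ^ 2) ^ (-(μ / 2))

/-- The decaying function `(1 + |x|)^{-μ}`. -/
def decay {N : ℕ} (μ : ℝ) (x : Space N) : ℝ := (1 + ‖x‖) ^ (-μ)

lemma profile_pos {N : ℕ} (μ : ℝ) (x : Space N) : 0 < profile μ x := by
  unfold profile; positivity

lemma decay_pos {N : ℕ} (μ : ℝ) (x : Space N) : 0 < decay μ x := by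
  unfold decay; positivity

lemma continuous_profile {N : ℕ} (μ : ℝ) : Continuous (profile μ : Space N → ℝ) := by
  unfold profile
  exact (by fun_prop : Continuous fun x : Space N => 1 + ‖x‖ ^ 2).rpow_const
    fun x => Or.inl (by positivity)

lemma sq_rpow_neg_half {t : ℝ} (ht : 0 ≤ t) (μ : ℝ) : (t ^ 2) ^ (-(μ / 2)) = t ^ (-μ) := by
  rw [← Real.rpow_natCast t 2, ← Real.rpow_mul ht]
  congr 1; push_cast; ring

lemma decay_le_profile {N : ℕ} {μ : ℝ} (hμ : 0 < μ) (x : Space N) :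
    decay μ x ≤ profile μ x := by
  have h : 0 ≤ ‖x‖ := norm_nonneg x
  unfold decay profile
  rw [← sq_rpow_neg_half (by positivity)]
  exact Real.rpow_le_rpow_of_nonpos (by positivity) (by nlinarith) (by linarith)

lemma profile_smul_le_decay {N : ℕ} {μ δ : ℝ} (hμ : 0 < μ) (hδ : 0 < δ) (hδ' : δ ≤ 1)
    (x : Space N) : profile μ (δ • x) ≤ (δ / 2) ^ (-μ) * decay μ x := by
  have h : 0 ≤ ‖x‖ := norm_nonneg x
  unfold decay profile
  rw [← Real.mul_rpow (by positivity) (by positivity),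
    ← sq_rpow_neg_half (t := δ / 2 * (1 + ‖x‖)) (by positivity), norm_smul,
    Real.norm_of_nonneg hδ.le]
  refine Real.rpow_le_rpow_of_nonpos (by positivity) ?_ (by linarith)
  have h1 : (1 + ‖x‖) ^ 2 ≤ 2 * (1 + ‖x‖ ^ 2) := by nlinarith [sq_nonneg (1 - ‖x‖)]
  have h2 : δ ^ 2 ≤ 1 := by nlinarith
  calc (δ / 2 * (1 + ‖x‖)) ^ 2 = δ ^ 2 / 4 * (1 + ‖x‖) ^ 2 := by ring
    _ ≤ δ ^ 2 / 4 * (2 * (1 + ‖x‖ ^ 2)) := by gcongr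
    _ ≤ 1 + (δ * ‖x‖) ^ 2 := by nlinarith [mul_nonneg (sq_nonneg δ) (sq_nonneg ‖x‖)]

lemma decay_le_profile_smul {N : ℕ} {μ δ : ℝ} (hμ : 0 < μ) (hδ : 0 < δ) (hδ' : δ ≤ 1)
    (x : Space N) : decay μ x ≤ profile μ (δ • x) := by
  refine le_trans ?_ (decay_le_profile hμ _)
  unfold decay
  refine Real.rpow_le_rpow_of_nonpos (by positivity) ?_ (by linarith)
  rw [norm_smul, Real.norm_of_nonneg hδ.le]
  nlinarith [norm_nonneg x]

/-- With `A = 1 + |x|² + |y|²` and `t = 2⟨x, y⟩/A` one has `1 + |x ± y|² = A(1 ± t)`, which reduces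
the claim to one variable. Here `|t| ≤ |y|`, because `2|x| ≤ 1 + |x|² ≤ A`. -/
lemma exists_profile_second_difference_near {N : ℕ} {μ : ℝ} (hμ : 0 < μ) :
    ∃ C : ℝ, 0 < C ∧ ∀ x y : Space N, ‖y‖ ≤ 1 / 2 →
      profile μ (x - y) + profile μ (x + y) - 2 * profile μ x ≤ C * ‖y‖ ^ 2 * profile μ x := by
  obtain ⟨C, hC, h⟩ := exists_rpow_neg_second_difference_le (half_pos hμ)
  refine ⟨C, hC, fun x y hy => ?_⟩
  set A := 1 + ‖x‖ ^ 2 + ‖y‖ ^ 2 with hA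
  have hA0 : 0 < A := by positivity
  set t := 2 * inner ℝ x y / A with ht
  have htA : A * t = 2 * inner ℝ x y := by rw [ht]; field_simp
  have htle : |t| ≤ ‖y‖ := by
    rw [ht, abs_div, abs_of_pos hA0, div_le_iff₀ hA0, abs_mul, abs_two]
    have h1 := abs_real_inner_le_norm x y
    nlinarith [norm_nonneg x, norm_nonneg y, sq_nonneg (‖x‖ - 1), sq_nonneg ‖y‖,
      mul_nonneg (norm_nonneg y) (sq_nonneg (‖x‖ - 1)), mul_nonneg (norm_nonneg y) (sq_nonneg ‖y‖)]
  have hth : |t| ≤ 1 / 2 := htle.trans hy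
  obtain ⟨hl, hr⟩ := abs_le.1 hth
  have hp : profile μ (x + y) = A ^ (-(μ / 2)) * (1 + t) ^ (-(μ / 2)) := by
    rw [← Real.mul_rpow hA0.le (by linarith), mul_add, htA, profile, norm_add_sq_real]
    congr 1; rw [hA]; ring
  have hm : profile μ (x - y) = A ^ (-(μ / 2)) * (1 - t) ^ (-(μ / 2)) := by
    rw [← Real.mul_rpow hA0.le (by linarith), mul_sub, htA, profile, norm_sub_sq_real]
    congr 1; rw [hA]; ring
  have hAle : A ^ (-(μ / 2)) ≤ profile μ x :=
    Real.rpow_le_rpow_of_nonpos (by positivity) (by rw [hA]; nlinarith [sq_nonneg ‖y‖])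
      (by linarith)
  have ht2 : t ^ 2 ≤ ‖y‖ ^ 2 := by
    rw [← sq_abs]; exact pow_le_pow_left₀ (abs_nonneg _) htle 2
  have hApos : 0 < A ^ (-(μ / 2)) := Real.rpow_pos_of_pos hA0 _
  have hb := profile_pos μ x
  have h0 : 0 ≤ (1 + t) ^ (-(μ / 2)) + (1 - t) ^ (-(μ / 2)) :=
    add_nonneg (Real.rpow_nonneg (by linarith) _) (Real.rpow_nonneg (by linarith) _)
  have h2 : (1 + t) ^ (-(μ / 2)) + (1 - t) ^ (-(μ / 2)) ≤ 2 + C * ‖y‖ ^ 2 :=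
    (h t hth).trans (by gcongr)
  calc profile μ (x - y) + profile μ (x + y) - 2 * profile μ x
      = A ^ (-(μ / 2)) * ((1 + t) ^ (-(μ / 2)) + (1 - t) ^ (-(μ / 2))) - 2 * profile μ x := by
        rw [hp, hm]; ring
    _ ≤ profile μ x * (2 + C * ‖y‖ ^ 2) - 2 * profile μ x := by gcongr
    _ = _ := by ring

lemma exists_profile_second_difference_mul_levyKernel_le {N : ℕ} {s μ : ℝ} (hs : 0 < s)
    (hμ : 0 < μ) (hμ' : μ < N + 2 * s) :
    ∃ C : ℝ, 0 < C ∧ ∀ x y : Space N,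
      (profile μ (x - y) + profile μ (x + y) - 2 * profile μ x) * levyKernel s y ≤
        profile μ x * (C * (min (‖y‖ ^ 2) 1 * levyKernel s y + decay (N + 2 * s) y +
          decay (N + 2 * s) (x - y) + decay (N + 2 * s) (x + y))) := by
  obtain ⟨C₁, hC₁, hnear⟩ := exists_profile_second_difference_near (N := N) hμ
  set n : ℝ := N + 2 * s with hn
  have hn0 : 0 < n := by positivity
  -- The factors come from `profile` against `decay`, from the kernel against `decay` when `|y| ≥
  -- 1/2`, and from `rpow_neg_mul_rpow_neg_le`.
  set D : ℝ := (1 / 2) ^ (-μ) * 3 ^ n * 2 ^ μ with hD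
  have hD0 : 0 < D := by positivity
  refine ⟨C₁ + 2 * D, by positivity, fun x y => ?_⟩
  have hk := levyKernel_nonneg s y
  have hb := profile_pos μ x
  have d0 := decay_pos n y
  have d1 := decay_pos n (x - y)
  have d2 := decay_pos n (x + y)
  have hm0 : 0 ≤ min (‖y‖ ^ 2) 1 * levyKernel s y := by positivity
  rcases le_total ‖y‖ (1 / 2) with hy | hy
  · have hmin : min (‖y‖ ^ 2) 1 = ‖y‖ ^ 2 := min_eq_left (by nlinarith [norm_nonneg y])
    have h1 := mul_le_mul_of_nonneg_right (hnear x y hy) hk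
    refine h1.trans ?_
    rw [hmin] at hm0 ⊢
    have h2 : C₁ * (‖y‖ ^ 2 * levyKernel s y) ≤ (C₁ + 2 * D) * (‖y‖ ^ 2 * levyKernel s y +
        decay n y + decay n (x - y) + decay n (x + y)) := by
      gcongr ?_ * ?_ <;> linarith
    calc C₁ * ‖y‖ ^ 2 * profile μ x * levyKernel s y
        = profile μ x * (C₁ * (‖y‖ ^ 2 * levyKernel s y)) := by ring
      _ ≤ _ := by gcongr
  -- For `|y| ≥ 1/2` one has `(1 + |y|)/3 ≤ |y|`.
  · have hkd : levyKernel s y ≤ 3 ^ n * decay n y := by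
      have h3 : (3 : ℝ) ^ n * decay n y = ((1 + ‖y‖) / 3) ^ (-n) := by
        rw [decay, Real.div_rpow (by positivity) (by positivity),
          Real.rpow_neg (by norm_num : (0 : ℝ) ≤ 3) n, div_inv_eq_mul, mul_comm]
      rw [h3]
      exact Real.rpow_le_rpow_of_nonpos (by positivity) (by linarith) (by linarith)
    have hfar : ∀ z : Space N, ‖x‖ ≤ ‖z‖ + ‖y‖ →
        profile μ z * levyKernel s y ≤ D * profile μ x * (decay n z + decay n y) := by
      intro z hz
      have e1 := profile_smul_le_decay hμ one_pos le_rfl z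
      rw [one_smul] at e1
      have e2 : decay μ z * decay n y ≤ 2 ^ μ * decay μ x * (decay n z + decay n y) :=
        rpow_neg_mul_rpow_neg_le (by positivity) (by positivity) (by positivity) (by linarith)
          hμ hμ'.le
      have d3 := decay_pos μ z
      have d4 := decay_pos n z
      have e3 := decay_le_profile hμ x
      calc profile μ z * levyKernel s y
          ≤ ((1 / 2) ^ (-μ) * decay μ z) * (3 ^ n * decay n y) := by gcongr
        _ = (1 / 2) ^ (-μ) * 3 ^ n * (decay μ z * decay n y) := by ring
        _ ≤ (1 / 2) ^ (-μ) * 3 ^ n * (2 ^ μ * decay μ x * (decay n z + decay n y)) := by gcongr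
        _ ≤ (1 / 2) ^ (-μ) * 3 ^ n * (2 ^ μ * profile μ x * (decay n z + decay n y)) := by gcongr
        _ = _ := by rw [hD]; ring
    have f1 := hfar (x - y) (by simpa using norm_add_le (x - y) y)
    have f2 := hfar (x + y) (by simpa using norm_sub_le (x + y) y)
    have f3 : 0 ≤ profile μ x * levyKernel s y := by positivity
    calc (profile μ (x - y) + profile μ (x + y) - 2 * profile μ x) * levyKernel s y
        ≤ D * profile μ x * (decay n (x - y) + decay n y) +
          D * profile μ x * (decay n (x + y) + decay n y) := by linarith
      _ = profile μ x * (D * (2 * decay n y + decay n (x - y) + decay n (x + y))) := by ring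
      _ ≤ profile μ x * ((C₁ + 2 * D) * (min (‖y‖ ^ 2) 1 * levyKernel s y + decay n y +
          decay n (x - y) + decay n (x + y))) := by
        gcongr profile μ x * ?_
        nlinarith [mul_nonneg hC₁.le hm0, mul_nonneg hD0.le hm0, mul_pos hC₁ d0, mul_pos hC₁ d1,
          mul_pos hC₁ d2, mul_pos hD0 d1, mul_pos hD0 d2]

lemma integrable_decay {N : ℕ} {n : ℝ} (hn : (N : ℝ) < n) :
    Integrable (decay n : Space N → ℝ) :=
  integrable_one_add_norm (by rwa [finrank_euclideanSpace_fin])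

/-- The three `decay` terms of the pointwise bound have the same integral in `y`, by translation and
reflection invariance, so the constant is uniform in `x`. -/
theorem exists_lintegral_profile_second_difference_le {N : ℕ} (hN : 1 ≤ N) {s μ : ℝ} (hs : 0 < s)
    (hs' : s < 1) (hμ : 0 < μ) (hμ' : μ < N + 2 * s) :
    ∃ C : ℝ, 0 < C ∧ ∀ x : Space N,
      ∫⁻ y : Space N, ENNReal.ofReal
        ((profile μ (x - y) + profile μ (x + y) - 2 * profile μ x) * levyKernel s y) ≤
        ENNReal.ofReal (C * profile μ x) := by
  obtain ⟨C, hC, h⟩ := exists_profile_second_difference_mul_levyKernel_le (N := N) hs hμ hμ'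
  have i0 := integrable_min_sq_mul_levyKernel hN hs hs'
  have i1 := integrable_decay (N := N) (n := N + 2 * s) (by linarith)
  set I := (∫ y : Space N, min (‖y‖ ^ 2) 1 * levyKernel s y) +
    3 * ∫ y : Space N, decay (N + 2 * s) y with hI
  have hI0 : 0 ≤ I := by
    refine add_nonneg (integral_nonneg fun y => ?_)
      (mul_nonneg (by norm_num) (integral_nonneg fun y => (decay_pos _ y).le))
    exact mul_nonneg (by positivity) (levyKernel_nonneg _ _)
  -- The summand `1` only makes the constant visibly positive.
  refine ⟨C * I + 1, by positivity, fun x => ?_⟩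
  have i2 := i1.comp_sub_left x
  have i3 := i1.comp_add_left x
  have i4 := (((i0.add i1).add i2).add i3).const_mul C |>.const_mul (profile μ x)
  have hnn : ∀ y : Space N, 0 ≤ profile μ x * (C * (min (‖y‖ ^ 2) 1 * levyKernel s y +
      decay (N + 2 * s) y + decay (N + 2 * s) (x - y) + decay (N + 2 * s) (x + y))) := by
    intro y
    have := levyKernel_nonneg s y
    have := profile_pos μ x
    have := decay_pos (N + 2 * s) y
    have := decay_pos (N + 2 * s) (x - y)
    have := decay_pos (N + 2 * s) (x + y)
    positivity
  calc _ ≤ ∫⁻ y : Space N, ENNReal.ofReal (profile μ x * (C * (min (‖y‖ ^ 2) 1 * levyKernel s y +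
      decay (N + 2 * s) y + decay (N + 2 * s) (x - y) + decay (N + 2 * s) (x + y)))) :=
        lintegral_mono fun y => ENNReal.ofReal_le_ofReal (h x y)
    _ = ENNReal.ofReal (∫ y : Space N, profile μ x * (C * (min (‖y‖ ^ 2) 1 * levyKernel s y +
      decay (N + 2 * s) y + decay (N + 2 * s) (x - y) + decay (N + 2 * s) (x + y)))) :=
        (ofReal_integral_eq_lintegral_ofReal i4 (Filter.Eventually.of_forall hnn)).symm
    _ ≤ _ := by
      refine ENNReal.ofReal_le_ofReal ?_
      have e1 := integral_add ((i0.add i1).add i2) i3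
      have e2 := integral_add (i0.add i1) i2
      have e3 := integral_add i0 i1
      simp only [Pi.add_apply] at e1 e2 e3
      rw [integral_const_mul, integral_const_mul, e1, e2, e3,
        integral_sub_left_eq_self (decay (N + 2 * s)) volume x,
        integral_add_left_eq_self (decay (N + 2 * s)) x]
      have := profile_pos μ x
      rw [hI]
      linarith

lemma lintegral_comp_smul_of_pos {N : ℕ} (f : Space N → ℝ≥0∞) {r : ℝ} (hr : 0 < r) :
    ∫⁻ y : Space N, f (r • y) = ENNReal.ofReal (r ^ (-(N : ℝ))) * ∫⁻ y : Space N, f y := by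
  have h1 := lintegral_map_equiv (μ := (volume : Measure (Space N))) f
    (Homeomorph.smul (isUnit_iff_ne_zero.2 hr.ne').unit).toMeasurableEquiv
  have h2 := Measure.map_addHaar_smul (volume : Measure (Space N)) hr.ne'
  rw [finrank_euclideanSpace_fin, abs_of_pos (by positivity)] at h2
  have h3 : (Measure.map (fun y : Space N => r • y) volume) =
    Measure.map (Homeomorph.smul (isUnit_iff_ne_zero.2 hr.ne').unit).toMeasurableEquiv
      (volume : Measure (Space N)) := rfl
  rw [← h3] at h1
  rw [show (fun y : Space N => r • y) = (r • ·) from rfl, h2, lintegral_smul_measure] at h1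
  rw [Real.rpow_neg hr.le, Real.rpow_natCast]
  exact h1.symm

/-- Under `z = δy` the kernel gives `δ^{N+2s}` and the volume `δ^{-N}`; the remaining `δ^{2s}` is
the gain that makes slowly varying barriers work. -/
theorem exists_lintegral_profile_smul_second_difference_le {N : ℕ} (hN : 1 ≤ N) {s μ : ℝ}
    (hs : 0 < s) (hs' : s < 1) (hμ : 0 < μ) (hμ' : μ < N + 2 * s) :
    ∃ C : ℝ, 0 < C ∧ ∀ δ : ℝ, 0 < δ → ∀ x : Space N,
      ∫⁻ y : Space N, ENNReal.ofReal
        ((profile μ (δ • (x - y)) + profile μ (δ • (x + y)) - 2 * profile μ (δ • x)) *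
          levyKernel s y) ≤
        ENNReal.ofReal (C * δ ^ (2 * s) * profile μ (δ • x)) := by
  obtain ⟨C, hC, h⟩ := exists_lintegral_profile_second_difference_le hN hs hs' hμ hμ'
  refine ⟨C, hC, fun δ hδ x => ?_⟩
  set F : Space N → ℝ≥0∞ := fun z => ENNReal.ofReal ((profile μ (δ • x - z) +
    profile μ (δ • x + z) - 2 * profile μ (δ • x)) * levyKernel s z) with hF
  have h1 : ∀ y : Space N, ENNReal.ofReal
      ((profile μ (δ • (x - y)) + profile μ (δ • (x + y)) - 2 * profile μ (δ • x)) *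
        levyKernel s y) = ENNReal.ofReal (δ ^ ((N : ℝ) + 2 * s)) * F (δ • y) := by
    intro y
    have h2 : δ ^ ((N : ℝ) + 2 * s) * δ ^ (-((N : ℝ) + 2 * s)) = 1 := by
      rw [← Real.rpow_add hδ]; simp
    simp only [hF]
    rw [← ENNReal.ofReal_mul (by positivity), levyKernel_smul s hδ, smul_sub, smul_add]
    congr 1
    calc _ = (profile μ (δ • x - δ • y) + profile μ (δ • x + δ • y) - 2 * profile μ (δ • x)) *
        levyKernel s y * (δ ^ ((N : ℝ) + 2 * s) * δ ^ (-((N : ℝ) + 2 * s))) := by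
          rw [h2, mul_one]
      _ = _ := by ring
  rw [lintegral_congr h1, lintegral_const_mul' _ _ ENNReal.ofReal_ne_top, lintegral_comp_smul_of_pos F hδ,
    ← mul_assoc, ← ENNReal.ofReal_mul (by positivity), ← Real.rpow_add hδ]
  refine (mul_le_mul_right (h (δ • x)) _).trans (le_of_eq ?_)
  rw [← ENNReal.ofReal_mul (by positivity)]
  congr 1
  rw [show (N : ℝ) + 2 * s + -(N : ℝ) = 2 * s by ring]
  ring

/-! ### Translations under the `L²` Fourier transform. -/

/-- Translation `h ↦ h(· - y)` on `L²`. -/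
def translateL2 {N : ℕ} (y : Space N) (h : Lp (α := Space N) ℂ 2 volume) :
    Lp (α := Space N) ℂ 2 volume :=
  Lp.compMeasurePreserving (fun x => x - y) (measurePreserving_sub_right volume y) h

lemma coeFn_translateL2 {N : ℕ} (y : Space N) (h : Lp (α := Space N) ℂ 2 volume) :
    translateL2 y h =ᵐ[volume] fun x => h (x - y) :=
  Lp.coeFn_compMeasurePreserving h (measurePreserving_sub_right volume y)

lemma translateL2_toL2 {N : ℕ} (y : Space N) {u : Space N → ℝ} (hu : MemLp u 2 volume) :
    translateL2 y (toL2 u hu) =ᵐ[volume] fun x => ((u (x - y) : ℝ) : ℂ) :=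
  (coeFn_translateL2 y _).trans
    ((measurePreserving_sub_right volume y).quasiMeasurePreserving.ae_eq_comp
      (MemLp.coeFn_toLp (hu.ofReal (K := ℂ))))

/-- The character `ξ ↦ e^{-2πi⟨y, ξ⟩}`. -/
def expChar {N : ℕ} (y ξ : Space N) : ℂ := (Real.fourierChar (-inner ℝ y ξ) : ℂ)

lemma continuous_expChar {N : ℕ} (y : Space N) : Continuous (expChar y) := by
  unfold expChar
  exact continuous_subtype_val.comp (Real.continuous_fourierChar.comp (by fun_prop))

lemma memLp_top_expChar {N : ℕ} (y : Space N) : MemLp (expChar y) ∞ volume :=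
  memLp_top_of_bound (continuous_expChar y).aestronglyMeasurable 1
    (Filter.Eventually.of_forall fun ξ => by rw [expChar, Circle.norm_coe])

lemma expChar_add_expChar_neg {N : ℕ} (y ξ : Space N) :
    2 - expChar y ξ - expChar (-y) ξ = (cosSymbol y ((2 * Real.pi) • ξ) : ℂ) := by
  simp only [expChar, cosSymbol, Real.fourierChar_apply, inner_neg_left, neg_neg,
    inner_smul_right]
  push_cast
  rw [Complex.cos]
  ring_nf

lemma fourier_translate_schwartz {N : ℕ} (y : Space N) (g : SchwartzMap (Space N) ℂ)
    (ξ : Space N) :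
    𝓕 (g.compSubConstCLM ℂ y) ξ = expChar y ξ * 𝓕 g ξ := by
  rw [SchwartzMap.fourier_coe, SchwartzMap.fourier_coe]
  have h := congrFun (VectorFourier.fourierIntegral_comp_add_right Real.fourierChar volume
    (innerₗ (Space N)) g (-y)) ξ
  have h2 : (g.compSubConstCLM ℂ y : Space N → ℂ) = g ∘ fun v => v + -y := by
    ext v; simp [sub_eq_add_neg]
  rw [h2]
  refine h.trans ?_
  simp [expChar, Circle.smul_def]
  rfl

/-- Both sides are continuous in `h`, the right one because multiplication by a bounded character is
a bounded Hölder pairing; so Schwartz functions suffice. -/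
theorem fourier_translateL2 {N : ℕ} (y : Space N) (h : Lp (α := Space N) ℂ 2 volume) :
    (𝓕 (translateL2 y h) : Lp (α := Space N) ℂ 2 volume) =ᵐ[volume] fun ξ => expChar y ξ * (𝓕 h) ξ := by
  set c : Lp (α := Space N) ℂ ∞ volume := (memLp_top_expChar y).toLp _ with hc
  set B := ContinuousLinearMap.mul ℂ ℂ
  have hcae : c =ᵐ[volume] expChar y := MemLp.coeFn_toLp _
  have key : 𝓕 (translateL2 y h) = B.holderL volume ∞ 2 2 c (𝓕 h) := by
    refine DenseRange.induction_on
      (p := fun h => 𝓕 (translateL2 y h) = B.holderL volume ∞ 2 2 c (𝓕 h))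
      (SchwartzMap.denseRange_toLpCLM (F := ℂ) (μ := (volume : Measure (Space N)))
        (p := 2) ENNReal.ofNat_ne_top) h ?_ ?_
    · refine isClosed_eq ?_ ?_
      · exact (Lp.fourierTransformₗᵢ (Space N) ℂ).continuous.comp
          (Lp.isometry_compMeasurePreserving (measurePreserving_sub_right volume y)).continuous
      · exact (B.holderL volume ∞ 2 2 c).continuous.comp
          (Lp.fourierTransformₗᵢ (Space N) ℂ).continuous
    · intro g
      have h1 : translateL2 y (g.toLp 2) = (g.compSubConstCLM ℂ y).toLp 2 := by
        refine Lp.ext ?_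
        refine (coeFn_translateL2 y _).trans ?_
        refine ((measurePreserving_sub_right volume y).quasiMeasurePreserving.ae_eq_comp
          (g.coeFn_toLp 2 volume)).trans ?_
        exact ((g.compSubConstCLM ℂ y).coeFn_toLp 2 volume).symm
      show 𝓕 (translateL2 y (g.toLp 2)) = B.holderL volume ∞ 2 2 c (𝓕 (g.toLp 2))
      rw [h1, SchwartzMap.toLp_fourier_eq, SchwartzMap.toLp_fourier_eq]
      refine Lp.ext ?_
      filter_upwards [SchwartzMap.coeFn_toLp (𝓕 (g.compSubConstCLM ℂ y)) 2 volume,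
        SchwartzMap.coeFn_toLp (𝓕 g) 2 volume, hcae,
        B.coeFn_holder (r := 2) c ((𝓕 g).toLp 2 volume)] with ξ e1 e2 e3 e4
      rw [e1, fourier_translate_schwartz]
      refine Eq.trans ?_ e4.symm
      rw [e2, e3]
      rfl
  rw [key]
  filter_upwards [hcae, B.coeFn_holder (r := 2) c (𝓕 h)] with ξ e3 e4
  refine e4.trans ?_
  rw [e3]
  rfl

/-! ### The quadratic form as an integral of second differences. -/

/-- The product of `û` and the conjugate of `ŵ`. -/
def crossSpectrum {N : ℕ} (u w : Lp (α := Space N) ℂ 2 volume) (ξ : Space N) : ℂ :=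
  inner ℂ ((𝓕 w) ξ) ((𝓕 u) ξ)

lemma integrable_crossSpectrum {N : ℕ} (u w : Lp (α := Space N) ℂ 2 volume) :
    Integrable (crossSpectrum u w) :=
  L2.integrable_inner (𝓕 w) (𝓕 u)

lemma inner_toL2 {N : ℕ} {u w : Space N → ℝ} (hu : MemLp u 2 volume) (hw : MemLp w 2 volume) :
    (inner ℂ (toL2 w hw) (toL2 u hu) : ℂ) = ((∫ x, u x * w x : ℝ) : ℂ) := by
  rw [L2.inner_def, ← integral_complex_ofReal]
  refine integral_congr_ae ?_
  filter_upwards [MemLp.coeFn_toLp (hu.ofReal (K := ℂ)),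
    MemLp.coeFn_toLp (hw.ofReal (K := ℂ))] with x e1 e2
  have e1' : toL2 u hu x = (u x : ℂ) := e1
  have e2' : toL2 w hw x = (w x : ℂ) := e2
  rw [e1', e2']
  simp

/-- The pairing of the second difference of `u` in direction `y` with `w`. -/
def differencePairing {N : ℕ} (u w : Space N → ℝ) (y : Space N) : ℝ :=
  ∫ x, (2 * u x - u (x - y) - u (x + y)) * w x

theorem differencePairing_eq_integral_crossSpectrum {N : ℕ} {u w : Space N → ℝ}
    (hu : MemLp u 2 volume) (hw : MemLp w 2 volume) (y : Space N) :
    (differencePairing u w y : ℂ) = ∫ ξ : Space N,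
      (cosSymbol y ((2 * Real.pi) • ξ) : ℂ) * crossSpectrum (toL2 u hu) (toL2 w hw) ξ := by
  set U := toL2 u hu
  set V := toL2 w hw
  have hV : V =ᵐ[volume] fun x => (w x : ℂ) := MemLp.coeFn_toLp (hw.ofReal (K := ℂ))
  have hU : U =ᵐ[volume] fun x => (u x : ℂ) := MemLp.coeFn_toLp (hu.ofReal (K := ℂ))
  set T := (2 : ℂ) • U - translateL2 y U - translateL2 (-y) U with hT
  have h1 : (differencePairing u w y : ℂ) = inner ℂ V T := by
    rw [L2.inner_def, differencePairing, ← integral_complex_ofReal]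
    refine integral_congr_ae ?_
    filter_upwards [hU, hV, translateL2_toL2 y hu, translateL2_toL2 (-y) hu,
      Lp.coeFn_sub ((2 : ℂ) • U - translateL2 y U) (translateL2 (-y) U),
      Lp.coeFn_sub ((2 : ℂ) • U) (translateL2 y U), Lp.coeFn_smul (2 : ℂ) U]
      with x e1 e2 e3 e4 e5 e6 e7
    rw [hT, e5, Pi.sub_apply, e6, Pi.sub_apply, e7, Pi.smul_apply, e1, e2, e3, e4]
    simp
  rw [h1, ← Lp.inner_fourier_eq, L2.inner_def]
  refine integral_congr_ae ?_
  have h2 : 𝓕 T = (2 : ℂ) • 𝓕 U - 𝓕 (translateL2 y U) - 𝓕 (translateL2 (-y) U) := by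
    rw [hT]
    show Lp.fourierTransformₗᵢ (Space N) ℂ _ = _
    rw [map_sub, map_sub, map_smul]
    rfl
  rw [h2]
  filter_upwards [fourier_translateL2 y U, fourier_translateL2 (-y) U,
      Lp.coeFn_sub ((2 : ℂ) • 𝓕 U - 𝓕 (translateL2 y U)) (𝓕 (translateL2 (-y) U)),
      Lp.coeFn_sub ((2 : ℂ) • 𝓕 U) (𝓕 (translateL2 y U)), Lp.coeFn_smul (2 : ℂ) (𝓕 U)]
      with ξ e3 e4 e5 e6 e7
  rw [e5, Pi.sub_apply, e6, Pi.sub_apply, e7, Pi.smul_apply, e3, e4, crossSpectrum,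
    ← expChar_add_expChar_neg, smul_eq_mul, ← sub_mul, ← sub_mul, ← smul_eq_mul (2 - _ - _),
    inner_smul_right]

/-- Fubini's theorem for the Lévy kernel against a function in Fourier space. -/
lemma integral_integral_cosSymbol_levyKernel {N : ℕ} (hN : 1 ≤ N) {s : ℝ} (hs : 0 < s)
    (hs' : s < 1) {c : ℝ} (hc : ∀ ξ : Space N,
      ∫ y : Space N, cosSymbol y ξ * levyKernel s y = c * ‖ξ‖ ^ (2 * s))
    {G : Space N → ℂ} (hG : Integrable G)
    (hmul : Integrable (fun ξ : Space N => (((2 * Real.pi * ‖ξ‖) ^ (2 * s) : ℝ) : ℂ) * G ξ)) :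
    Integrable (fun y : Space N => ∫ ξ : Space N,
        ((cosSymbol y ((2 * Real.pi) • ξ) * levyKernel s y : ℝ) : ℂ) * G ξ) ∧
      ∫ y : Space N, ∫ ξ : Space N,
        ((cosSymbol y ((2 * Real.pi) • ξ) * levyKernel s y : ℝ) : ℂ) * G ξ =
      (c : ℂ) * ∫ ξ : Space N, (((2 * Real.pi * ‖ξ‖) ^ (2 * s) : ℝ) : ℂ) * G ξ := by
  have hsym : ∀ ξ : Space N, ∫ y : Space N, cosSymbol y ((2 * Real.pi) • ξ) * levyKernel s y =
      c * (2 * Real.pi * ‖ξ‖) ^ (2 * s) := by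
    intro ξ
    rw [hc, norm_smul, Real.norm_of_nonneg (by positivity)]
  have hc0 : ∀ ξ : Space N, 0 ≤ c * (2 * Real.pi * ‖ξ‖) ^ (2 * s) := by
    intro ξ
    rw [← hsym]
    exact integral_nonneg fun y => mul_nonneg (cosSymbol_nonneg _ _) (levyKernel_nonneg _ _)
  set H : Space N → Space N → ℂ := fun y ξ =>
    ((cosSymbol y ((2 * Real.pi) • ξ) * levyKernel s y : ℝ) : ℂ) * G ξ with hH
  have hHmeas : AEStronglyMeasurable (Function.uncurry H) (volume.prod volume) := by
    have h1 : Measurable fun p : Space N × Space N =>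
        cosSymbol p.1 ((2 * Real.pi) • p.2) * levyKernel s p.1 := by
      refine Measurable.mul ?_ ((measurable_levyKernel s).comp measurable_fst)
      exact (continuous_cosSymbol.comp (by fun_prop :
        Continuous fun p : Space N × Space N => (p.1, (2 * Real.pi) • p.2))).measurable
    exact (Complex.measurable_ofReal.comp h1).aestronglyMeasurable.mul
      hG.aestronglyMeasurable.comp_snd
  have hnorm : ∀ y ξ : Space N, ‖H y ξ‖ =
      cosSymbol y ((2 * Real.pi) • ξ) * levyKernel s y * ‖G ξ‖ := by
    intro y ξ
    rw [hH, norm_mul, Complex.norm_real, Real.norm_of_nonneg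
      (mul_nonneg (cosSymbol_nonneg _ _) (levyKernel_nonneg _ _))]
  -- Integrating the norm in `y` first produces the multiplier `(2π|ξ|)^{2s}`, which `hmul`
  -- controls.
  have hHint : Integrable (Function.uncurry H) (volume.prod volume) := by
    rw [integrable_prod_iff' hHmeas]
    constructor
    · refine Filter.Eventually.of_forall fun ξ => ?_
      have h1 := (integrable_cosSymbol_mul_levyKernel hN hs hs' ((2 * Real.pi) • ξ)).ofReal
        (𝕜 := ℂ)
      exact h1.mul_const (G ξ)
    · have h1 : ∀ ξ : Space N, ∫ y, ‖Function.uncurry H (y, ξ)‖ =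
          |c| * ‖(((2 * Real.pi * ‖ξ‖) ^ (2 * s) : ℝ) : ℂ) * G ξ‖ := by
        intro ξ
        simp only [Function.uncurry_apply_pair, hnorm]
        rw [integral_mul_const, hsym, norm_mul, Complex.norm_real, ← mul_assoc, Real.norm_eq_abs,
          ← abs_mul, abs_of_nonneg (hc0 ξ)]
      rw [funext h1]
      exact hmul.norm.const_mul |c|
  have hright : ∀ ξ : Space N, ∫ y, H y ξ =
      (c : ℂ) * ((((2 * Real.pi * ‖ξ‖) ^ (2 * s) : ℝ) : ℂ) * G ξ) := by
    intro ξ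
    simp only [hH]
    rw [integral_mul_const, integral_complex_ofReal, hsym, Complex.ofReal_mul, mul_assoc]
  refine ⟨hHint.integral_prod_left, ?_⟩
  have h1 := integral_integral_swap hHint
  rw [h1, funext hright, integral_const_mul]

/-- The quadratic form of the fractional Laplacian as an integral of second differences. -/
theorem integral_differencePairing_mul_levyKernel {N : ℕ} (hN : 1 ≤ N) {s : ℝ} (hs : 0 < s)
    (hs' : s < 1) {c : ℝ} (hc : ∀ ξ : Space N,
      ∫ y : Space N, cosSymbol y ξ * levyKernel s y = c * ‖ξ‖ ^ (2 * s))
    {u f w : Space N → ℝ} (hf : IsFracLaplacian s u f) (hw : MemLp w 2 volume) :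
    Integrable (fun y => differencePairing u w y * levyKernel s y) ∧
      ∫ y, differencePairing u w y * levyKernel s y = c * ∫ x, f x * w x := by
  obtain ⟨hu, hf2, hae⟩ := hf
  -- The whole multiplier is absorbed into `f ∈ L²`, so no regularity of `w` beyond `L²` is needed.
  have hcross : ∀ᵐ ξ : Space N, crossSpectrum (toL2 f hf2) (toL2 w hw) ξ =
      (((2 * Real.pi * ‖ξ‖) ^ (2 * s) : ℝ) : ℂ) *
        crossSpectrum (toL2 u hu) (toL2 w hw) ξ := by
    filter_upwards [hae] with ξ hξ
    rw [crossSpectrum, crossSpectrum, hξ, ← smul_eq_mul, inner_smul_right]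
  obtain ⟨h1, h2⟩ := integral_integral_cosSymbol_levyKernel hN hs hs' hc
    (integrable_crossSpectrum (toL2 u hu) (toL2 w hw))
    ((integrable_crossSpectrum (toL2 f hf2) (toL2 w hw)).congr hcross)
  have hleft : ∀ y : Space N, ∫ ξ : Space N,
      ((cosSymbol y ((2 * Real.pi) • ξ) * levyKernel s y : ℝ) : ℂ) *
        crossSpectrum (toL2 u hu) (toL2 w hw) ξ =
      ((differencePairing u w y * levyKernel s y : ℝ) : ℂ) := by
    intro y
    rw [Complex.ofReal_mul, differencePairing_eq_integral_crossSpectrum hu hw,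
      ← integral_mul_const]
    refine integral_congr_ae (Filter.Eventually.of_forall fun ξ => ?_)
    simp only [Complex.ofReal_mul]
    ring
  rw [funext hleft] at h1 h2
  constructor
  · simpa using h1.re
  · rw [integral_complex_ofReal, ← integral_congr_ae hcross] at h2
    have h3 : ∫ ξ : Space N, crossSpectrum (toL2 f hf2) (toL2 w hw) ξ =
        inner ℂ (𝓕 (toL2 w hw)) (𝓕 (toL2 f hf2)) := (L2.inner_def _ _).symm
    rw [h3, Lp.inner_fourier_eq, inner_toL2] at h2
    exact_mod_cast h2

/-! ### Comparison with a barrier. -/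

lemma ofReal_integral_le_lintegral_ofReal {α : Type*} [MeasurableSpace α] {ν : Measure α}
    (f : α → ℝ) : ENNReal.ofReal (∫ x, f x ∂ν) ≤ ∫⁻ x, ENNReal.ofReal (f x) ∂ν := by
  by_cases hf : Integrable f ν
  · rw [integral_eq_lintegral_pos_part_sub_lintegral_neg_part hf]
    refine (ENNReal.ofReal_le_ofReal (sub_le_self _ ENNReal.toReal_nonneg)).trans ?_
    exact ENNReal.ofReal_toReal_le
  · rw [integral_undef hf]; simp

lemma memLp_comp_sub {N : ℕ} {u : Space N → ℝ} (hu : MemLp u 2 volume) (y : Space N) :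
    MemLp (fun x => u (x - y)) 2 volume :=
  hu.comp_measurePreserving (measurePreserving_sub_right volume y)

lemma memLp_comp_add {N : ℕ} {u : Space N → ℝ} (hu : MemLp u 2 volume) (y : Space N) :
    MemLp (fun x => u (x + y)) 2 volume :=
  hu.comp_measurePreserving (measurePreserving_add_right volume y)

lemma memLp_second_difference {N : ℕ} {u : Space N → ℝ} (hu : MemLp u 2 volume) (y : Space N) :
    MemLp (fun x => 2 * u x - u (x - y) - u (x + y)) 2 volume :=
  ((hu.const_mul 2).sub (memLp_comp_sub hu y)).sub (memLp_comp_add hu y)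

lemma differencePairing_sub_const_mul {N : ℕ} {u v w : Space N → ℝ} (hu : MemLp u 2 volume)
    (hv : MemLp v 2 volume) (hw : MemLp w 2 volume) (K : ℝ) (y : Space N) :
    differencePairing (fun x => u x - K * v x) w y =
      differencePairing u w y - K * differencePairing v w y := by
  have h1 := (memLp_second_difference hu y).integrable_mul hw
  have h2 := ((memLp_second_difference hv y).integrable_mul hw).const_mul K
  unfold differencePairing
  rw [← integral_const_mul]
  refine Eq.trans ?_ (integral_sub h1 h2)
  refine integral_congr_ae (Filter.Eventually.of_forall fun x => ?_)
  simp only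
  ring

/-- Since `v w = w²` and `v ≤ w`, Young's inequality bounds the integrand below by `w(x)² - ½w(x-y)²
- ½w(x+y)²`, whose integral vanishes by translation invariance. -/
lemma differencePairing_posPart_nonneg {N : ℕ} {v : Space N → ℝ} (hv : MemLp v 2 volume)
    (y : Space N) : 0 ≤ differencePairing v (fun x => max (v x) 0) y := by
  set w : Space N → ℝ := fun x => max (v x) 0 with hw
  have hw2 : MemLp w 2 volume := hv.pos_part
  have i0 : Integrable (fun x => w x ^ 2) := hw2.integrable_sq
  have i1 : Integrable (fun x => w (x - y) ^ 2) := (memLp_comp_sub hw2 y).integrable_sq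
  have i2 : Integrable (fun x => w (x + y) ^ 2) := (memLp_comp_add hw2 y).integrable_sq
  have h0 : ∫ x, (w x ^ 2 - (1 / 2) * w (x - y) ^ 2 - (1 / 2) * w (x + y) ^ 2) = 0 := by
    have e1 := integral_sub (i0.sub (i1.const_mul (1 / 2))) (i2.const_mul (1 / 2))
    have e2 := integral_sub i0 (i1.const_mul (1 / 2))
    simp only [Pi.sub_apply] at e1 e2
    rw [e1, e2, integral_const_mul, integral_const_mul,
      integral_sub_right_eq_self (fun x => w x ^ 2) y,
      integral_add_right_eq_self (fun x => w x ^ 2) y]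
    ring
  rw [← h0]
  refine integral_mono ((i0.sub (i1.const_mul _)).sub (i2.const_mul _))
    ((memLp_second_difference hv y).integrable_mul hw2) fun x => ?_
  have hwn : 0 ≤ w x := le_max_right _ _
  have h1 : v (x - y) ≤ w (x - y) := le_max_left _ _
  have h2 : v (x + y) ≤ w (x + y) := le_max_left _ _
  have h3 : v x * w x = w x * w x := by
    rcases le_total (v x) 0 with h | h
    · simp [hw, max_eq_right h]
    · simp [hw, max_eq_left h]
  show w x ^ 2 - 1 / 2 * w (x - y) ^ 2 - 1 / 2 * w (x + y) ^ 2 ≤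
    (2 * v x - v (x - y) - v (x + y)) * w x
  nlinarith [mul_le_mul_of_nonneg_right h1 hwn, mul_le_mul_of_nonneg_right h2 hwn,
    sq_nonneg (w (x - y) - w x), sq_nonneg (w (x + y) - w x)]

/-- The second differences of `ψ`, integrated against the Lévy kernel, are at most `ε ψ`; this is
a pointwise form of `-(-Δ)^s ψ ≤ const · ε ψ`. -/
def IsBarrier {N : ℕ} (s ε : ℝ) (ψ : Space N → ℝ) : Prop :=
  ∀ x : Space N, ∫⁻ y : Space N, ENNReal.ofReal
    ((ψ (x - y) + ψ (x + y) - 2 * ψ x) * levyKernel s y) ≤ ENNReal.ofReal (ε * ψ x)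

/-- This is the weak form of `(-Δ)^s u ≥ -Kεψ` tested with `w = (u - Kψ)₊`. Positive parts in `ℝ≥0∞`
let Tonelli exchange the integrals without any integrability of the second differences of `ψ`
against the kernel. -/
lemma neg_integral_mul_posPart_le {N : ℕ} (hN : 1 ≤ N) {s : ℝ} (hs : 0 < s) (hs' : s < 1)
    {c : ℝ} (hc0 : 0 < c) (hc : ∀ ξ : Space N,
      ∫ y : Space N, cosSymbol y ξ * levyKernel s y = c * ‖ξ‖ ^ (2 * s))
    {ε : ℝ} (hε : 0 ≤ ε) {ψ : Space N → ℝ} (hψc : Continuous ψ) (hψ0 : ∀ x, 0 ≤ ψ x)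
    (hψ : MemLp ψ 2 volume) (hbar : IsBarrier s (c * ε) ψ)
    {u f : Space N → ℝ} (hf : IsFracLaplacian s u f) {K : ℝ} (hK : 0 ≤ K) :
    -(∫ x, f x * max (u x - K * ψ x) 0) ≤ K * ε * ∫ x, ψ x * max (u x - K * ψ x) 0 := by
  have hu : MemLp u 2 volume := hf.1
  have hv : MemLp (fun x => u x - K * ψ x) 2 volume := hu.sub (hψ.const_mul K)
  set w : Space N → ℝ := fun x => max (u x - K * ψ x) 0 with hw
  have hw2 : MemLp w 2 volume := hv.pos_part
  have hw0 : ∀ x, 0 ≤ w x := fun x => le_max_right _ _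
  obtain ⟨-, hint⟩ := integral_differencePairing_mul_levyKernel hN hs hs' hc hf hw2
  have hpair : ∀ y, -differencePairing u w y ≤ K * -differencePairing ψ w y := by
    intro y
    have h1 := differencePairing_posPart_nonneg hv y
    rw [differencePairing_sub_const_mul hu hψ hw2] at h1
    linarith
  have hψw : Integrable (fun x => ψ x * w x) := hψ.integrable_mul hw2
  have hψw0 : 0 ≤ ∫ x, ψ x * w x := integral_nonneg fun x => mul_nonneg (hψ0 x) (hw0 x)
  have hpoint : ∀ y, ENNReal.ofReal (-differencePairing u w y * levyKernel s y) ≤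
      ENNReal.ofReal K * ∫⁻ x, ENNReal.ofReal
        ((ψ (x - y) + ψ (x + y) - 2 * ψ x) * levyKernel s y) * ENNReal.ofReal (w x) := by
    intro y
    have hk := levyKernel_nonneg s y
    have h1 : -differencePairing u w y * levyKernel s y ≤
        K * ∫ x, (ψ (x - y) + ψ (x + y) - 2 * ψ x) * levyKernel s y * w x := by
      have h2 : ∫ x, (ψ (x - y) + ψ (x + y) - 2 * ψ x) * levyKernel s y * w x =
          -differencePairing ψ w y * levyKernel s y := by
        rw [differencePairing, ← integral_neg, ← integral_mul_const]
        refine integral_congr_ae (Filter.Eventually.of_forall fun x => ?_)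
        simp only
        ring
      rw [h2, ← mul_assoc]
      exact mul_le_mul_of_nonneg_right (hpair y) hk
    refine (ENNReal.ofReal_le_ofReal h1).trans ?_
    rw [ENNReal.ofReal_mul hK]
    gcongr
    refine (ofReal_integral_le_lintegral_ofReal _).trans (le_of_eq ?_)
    exact lintegral_congr fun x => ENNReal.ofReal_mul' (hw0 x)
  have hmeas : AEMeasurable (Function.uncurry fun (y x : Space N) => ENNReal.ofReal
      ((ψ (x - y) + ψ (x + y) - 2 * ψ x) * levyKernel s y) * ENNReal.ofReal (w x))
      (volume.prod volume) := by
    have h1 : Measurable fun p : Space N × Space N =>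
        ψ (p.2 - p.1) + ψ (p.2 + p.1) - 2 * ψ p.2 := by fun_prop
    have h2 : Measurable fun p : Space N × Space N => levyKernel s p.1 :=
      (measurable_levyKernel s).comp measurable_fst
    have h3 : AEMeasurable (fun p : Space N × Space N => w p.2) (volume.prod volume) :=
      hw2.aestronglyMeasurable.comp_snd.aemeasurable
    exact (h1.mul h2).ennreal_ofReal.aemeasurable.mul h3.ennreal_ofReal
  have hmain : ENNReal.ofReal (-(c * ∫ x, f x * w x)) ≤
      ENNReal.ofReal (K * (c * ε * ∫ x, ψ x * w x)) := by
    have e1 : -(c * ∫ x, f x * w x) = ∫ y, -differencePairing u w y * levyKernel s y := by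
      rw [← hint, ← integral_neg]
      simp only [neg_mul]
    have hpos : 0 ≤ c * ε := by positivity
    calc ENNReal.ofReal (-(c * ∫ x, f x * w x))
        ≤ ∫⁻ y, ENNReal.ofReal (-differencePairing u w y * levyKernel s y) := by
          rw [e1]; exact ofReal_integral_le_lintegral_ofReal _
      _ ≤ ∫⁻ y, ENNReal.ofReal K * ∫⁻ x, ENNReal.ofReal
        ((ψ (x - y) + ψ (x + y) - 2 * ψ x) * levyKernel s y) * ENNReal.ofReal (w x) :=
          lintegral_mono hpoint
      _ = ENNReal.ofReal K * ∫⁻ x, ∫⁻ y, ENNReal.ofReal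
        ((ψ (x - y) + ψ (x + y) - 2 * ψ x) * levyKernel s y) * ENNReal.ofReal (w x) := by
          rw [lintegral_const_mul' _ _ ENNReal.ofReal_ne_top, lintegral_lintegral_swap hmeas]
      _ ≤ ENNReal.ofReal K * ∫⁻ x, ENNReal.ofReal (c * ε * (ψ x * w x)) := by
          gcongr with x
          rw [lintegral_mul_const' _ _ ENNReal.ofReal_ne_top, ← mul_assoc,
            ENNReal.ofReal_mul' (hw0 x)]
          gcongr
          exact hbar x
      _ = ENNReal.ofReal (K * (c * ε * ∫ x, ψ x * w x)) := by
          rw [ENNReal.ofReal_mul hK, ← integral_const_mul, ofReal_integral_eq_lintegral_ofReal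
            (hψw.const_mul _) (Filter.Eventually.of_forall fun x =>
              mul_nonneg hpos (mul_nonneg (hψ0 x) (hw0 x)))]
  have hmain' := (ENNReal.ofReal_le_ofReal_iff (by positivity)).1 hmain
  refine le_of_mul_le_mul_left (a := c) ?_ hc0
  linarith

/-- Comparison with a barrier. -/
theorem ae_le_mul_barrier {N : ℕ} (hN : 1 ≤ N) {s : ℝ} (hs : 0 < s) (hs' : s < 1)
    {c : ℝ} (hc0 : 0 < c) (hc : ∀ ξ : Space N,
      ∫ y : Space N, cosSymbol y ξ * levyKernel s y = c * ‖ξ‖ ^ (2 * s))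
    {m : ℝ} (hm : 0 < m) {ψ : Space N → ℝ} (hψc : Continuous ψ) (hψ0 : ∀ x, 0 ≤ ψ x)
    (hψ : MemLp ψ 2 volume) (hbar : IsBarrier s (c * (m / 2)) ψ)
    {u f : Space N → ℝ} (hf : IsFracLaplacian s u f) {K : ℝ} (hK : 0 ≤ K)
    (hsub : ∀ᵐ x, K * ψ x < u x → f x + m * u x ≤ m / 2 * (K * ψ x)) :
    ∀ᵐ x, u x ≤ K * ψ x := by
  have h := neg_integral_mul_posPart_le hN hs hs' hc0 hc (half_pos hm).le hψc hψ0 hψ hbar hf hK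
  obtain ⟨hu, hf2, -⟩ := hf
  set w : Space N → ℝ := fun x => max (u x - K * ψ x) 0 with hw
  have hw2 : MemLp w 2 volume := MemLp.pos_part (hu.sub (hψ.const_mul K))
  have hw0 : ∀ x, 0 ≤ w x := fun x => le_max_right _ _
  have i1 : Integrable (fun x => f x * w x) := hf2.integrable_mul hw2
  have i2 : Integrable (fun x => ψ x * w x) := hψ.integrable_mul hw2
  have i3 : Integrable (fun x => w x ^ 2) := hw2.integrable_sq
  have hle : ∫ x, f x * w x ≤ ∫ x, (-(K * (m / 2)) * (ψ x * w x) - m * w x ^ 2) := by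
    refine integral_mono_ae i1 ((i2.const_mul _).sub (i3.const_mul _)) ?_
    filter_upwards [hsub] with x hx
    rcases le_or_gt (u x) (K * ψ x) with h1 | h1
    · have : w x = 0 := max_eq_right (by linarith)
      simp [this]
    · have h2 : w x = u x - K * ψ x := max_eq_left (by linarith)
      -- Substitute `u = w + Kψ` in `hsub`: half of `mKψ` is left to cancel the barrier term in `h`.
      have h3 : f x ≤ -(K * (m / 2)) * ψ x - m * w x := by rw [h2]; linarith [hx h1]
      calc f x * w x ≤ (-(K * (m / 2)) * ψ x - m * w x) * w x :=
            mul_le_mul_of_nonneg_right h3 (hw0 x)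
        _ = _ := by ring
  rw [integral_sub (i2.const_mul _) (i3.const_mul _), integral_const_mul,
    integral_const_mul] at hle
  have h4 : m * ∫ x, w x ^ 2 ≤ 0 := by linarith
  have h5 : ∫ x, w x ^ 2 = 0 :=
    le_antisymm (nonpos_of_mul_nonpos_right h4 hm) (integral_nonneg fun x => sq_nonneg _)
  rw [integral_eq_zero_iff_of_nonneg (fun x => sq_nonneg _) i3] at h5
  filter_upwards [h5] with x hx
  have h6 : w x = 0 := by simpa using hx
  have h7 : u x - K * ψ x ≤ w x := le_max_left _ _
  linarith

lemma IsFracLaplacian.neg {N : ℕ} {s : ℝ} {u f : Space N → ℝ} (h : IsFracLaplacian s u f) :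
    IsFracLaplacian s (-u) (-f) := by
  obtain ⟨hu, hf, hae⟩ := h
  have key : ∀ {v : Space N → ℝ} (hv : MemLp v 2 volume),
      𝓕 (toL2 (-v) hv.neg) = -𝓕 (toL2 v hv) := by
    intro v hv
    have h1 : toL2 (-v) hv.neg = -toL2 v hv := by
      refine Lp.ext ?_
      filter_upwards [MemLp.coeFn_toLp (hv.neg.ofReal (K := ℂ)),
        MemLp.coeFn_toLp (hv.ofReal (K := ℂ)), Lp.coeFn_neg (toL2 v hv)] with x e1 e2 e3
      rw [e3, Pi.neg_apply]
      refine e1.trans ?_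
      rw [show toL2 v hv x = (v x : ℂ) from e2]
      simp
    rw [h1]
    exact map_neg (Lp.fourierTransformₗᵢ (Space N) ℂ) (toL2 v hv)
  refine ⟨hu.neg, hf.neg, ?_⟩
  rw [key hu, key hf]
  filter_upwards [hae, Lp.coeFn_neg (𝓕 (toL2 u hu)), Lp.coeFn_neg (𝓕 (toL2 f hf))]
    with ξ e1 e2 e3
  rw [e2, e3, Pi.neg_apply, Pi.neg_apply, e1, mul_neg]

/-! ### The multi-centre barrier and the weight. -/

/-- The barrier `∑_j (1 + δ² |x - q_j|²)^{-μ/2}`. -/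
def barrier {N k : ℕ} (μ δ : ℝ) (q : Fin k → Space N) (x : Space N) : ℝ :=
  ∑ j, profile μ (δ • (x - q j))

lemma barrier_nonneg {N k : ℕ} (μ δ : ℝ) (q : Fin k → Space N) (x : Space N) :
    0 ≤ barrier μ δ q x :=
  Finset.sum_nonneg fun _ _ => (profile_pos _ _).le

lemma continuous_barrier {N k : ℕ} (μ δ : ℝ) (q : Fin k → Space N) :
    Continuous (barrier μ δ q) :=
  continuous_finsetSum _ fun _ _ => (continuous_profile μ).comp (by fun_prop)

lemma memLp_profile_smul {N : ℕ} {μ δ : ℝ} (hμ0 : 0 < μ) (hμ : (N : ℝ) / 2 < μ) (hδ : 0 < δ)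
    (hδ' : δ ≤ 1) : MemLp (fun x : Space N => profile μ (δ • x)) 2 volume := by
  have hc : Continuous (fun x : Space N => profile μ (δ • x)) :=
    (continuous_profile μ).comp (by fun_prop)
  rw [memLp_two_iff_integrable_sq hc.aestronglyMeasurable]
  refine ((integrable_decay (N := N) (n := 2 * μ) (by linarith)).const_mul
    (((δ / 2) ^ (-μ)) ^ 2)).mono' (hc.pow 2).aestronglyMeasurable
    (Filter.Eventually.of_forall fun x => ?_)
  rw [Real.norm_of_nonneg (sq_nonneg _)]
  have h1 : decay (2 * μ) x = decay μ x ^ 2 := by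
    unfold decay
    rw [← Real.rpow_natCast, ← Real.rpow_mul (by positivity)]
    congr 1; push_cast; ring
  rw [h1, ← mul_pow]
  exact pow_le_pow_left₀ (profile_pos _ _).le (profile_smul_le_decay hμ0 hδ hδ' x) 2

lemma memLp_barrier {N k : ℕ} {μ δ : ℝ} (hμ0 : 0 < μ) (hμ : (N : ℝ) / 2 < μ) (hδ : 0 < δ)
    (hδ' : δ ≤ 1) (q : Fin k → Space N) : MemLp (barrier μ δ q) 2 volume :=
  memLp_finsetSum _ fun j _ => memLp_comp_sub (memLp_profile_smul hμ0 hμ hδ hδ') (q j)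

/-- The positive part is subadditive, so the single-centre bounds add up with the same `ε`, whatever
`k` is. -/
lemma isBarrier_barrier {N k : ℕ} {s μ δ ε : ℝ} (q : Fin k → Space N) (hε : 0 ≤ ε)
    (h : ∀ x : Space N, ∫⁻ y : Space N, ENNReal.ofReal
      ((profile μ (δ • (x - y)) + profile μ (δ • (x + y)) - 2 * profile μ (δ • x)) *
        levyKernel s y) ≤ ENNReal.ofReal (ε * profile μ (δ • x))) :
    IsBarrier s ε (barrier μ δ q) := by
  intro x
  set F : Fin k → Space N → ℝ := fun j y =>
    (profile μ (δ • (x - q j - y)) + profile μ (δ • (x - q j + y)) -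
      2 * profile μ (δ • (x - q j))) * levyKernel s y with hF
  have hFm : ∀ j, Measurable (F j) := by
    intro j
    refine Measurable.mul ?_ (measurable_levyKernel s)
    have := continuous_profile (N := N) μ
    exact (by fun_prop : Continuous fun y => profile μ (δ • (x - q j - y)) +
      profile μ (δ • (x - q j + y)) - 2 * profile μ (δ • (x - q j))).measurable
  have h1 : ∀ y, (barrier μ δ q (x - y) + barrier μ δ q (x + y) - 2 * barrier μ δ q x) *
      levyKernel s y = ∑ j, F j y := by
    intro y
    simp only [barrier, hF]
    rw [← Finset.sum_mul, Finset.sum_sub_distrib, Finset.sum_add_distrib, Finset.mul_sum]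
    simp only [sub_right_comm x y, sub_add_eq_add_sub]
  calc _ ≤ ∫⁻ y, ∑ j, ENNReal.ofReal (F j y) := by
        refine lintegral_mono fun y => ?_
        rw [h1]
        exact Finset.le_sum_of_subadditive _ ENNReal.ofReal_zero.le
          (fun a b => ENNReal.ofReal_add_le) _ _
    _ = ∑ j, ∫⁻ y, ENNReal.ofReal (F j y) :=
        lintegral_finsetSum _ fun j _ => (hFm j).ennreal_ofReal
    _ ≤ ∑ j, ENNReal.ofReal (ε * profile μ (δ • (x - q j))) :=
        Finset.sum_le_sum fun j _ => h (x - q j)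
    _ = ENNReal.ofReal (ε * barrier μ δ q x) := by
        rw [← ENNReal.ofReal_sum_of_nonneg fun j _ => mul_nonneg hε (profile_pos _ _).le,
          ← Finset.mul_sum]
        rfl

lemma weight_eq_sum_decay {N k : ℕ} (μ : ℝ) (q : Fin k → Space N) (x : Space N) :
    weight μ q x = ∑ j, decay μ (x - q j) :=
  Finset.sum_congr rfl fun j _ => by
    rw [decay, Real.rpow_neg (by positivity), one_div]

lemma weight_pos {N k : ℕ} (hk : 1 ≤ k) (μ : ℝ) (q : Fin k → Space N) (x : Space N) :
    0 < weight μ q x := by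
  rw [weight_eq_sum_decay]
  exact Finset.sum_pos (fun j _ => decay_pos _ _) ⟨⟨0, hk⟩, Finset.mem_univ _⟩

lemma weight_le_barrier {N k : ℕ} {μ δ : ℝ} (hμ : 0 < μ) (hδ : 0 < δ) (hδ' : δ ≤ 1)
    (q : Fin k → Space N) (x : Space N) : weight μ q x ≤ barrier μ δ q x := by
  rw [weight_eq_sum_decay]
  exact Finset.sum_le_sum fun j _ => decay_le_profile_smul hμ hδ hδ' _

lemma barrier_le_weight {N k : ℕ} {μ δ : ℝ} (hμ : 0 < μ) (hδ : 0 < δ) (hδ' : δ ≤ 1)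
    (q : Fin k → Space N) (x : Space N) :
    barrier μ δ q x ≤ (δ / 2) ^ (-μ) * weight μ q x := by
  rw [weight_eq_sum_decay, Finset.mul_sum]
  exact Finset.sum_le_sum fun j _ => profile_smul_le_decay hμ hδ hδ' _

lemma one_le_mul_weight_of_mem_ballUnion {N k : ℕ} {μ R : ℝ} (hμ : 0 < μ) (hR : 0 < R)
    {q : Fin k → Space N} {x : Space N} (hx : x ∈ ballUnion R q) :
    1 ≤ (1 + R) ^ μ * weight μ q x := by
  obtain ⟨j, hj⟩ := Set.mem_iUnion.1 hx
  rw [mem_ball_iff_norm] at hj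
  have h1 : (1 + R) ^ (-μ) ≤ decay μ (x - q j) :=
    Real.rpow_le_rpow_of_nonpos (by positivity) (by linarith) (by linarith)
  have h2 : decay μ (x - q j) ≤ weight μ q x := by
    rw [weight_eq_sum_decay]
    exact Finset.single_le_sum (f := fun j => decay μ (x - q j))
      (fun j _ => (decay_pos _ _).le) (Finset.mem_univ j)
  have h3 : (1 + R) ^ μ * (1 + R) ^ (-μ) = 1 := by
    rw [← Real.rpow_add (by positivity)]; simp
  refine h3.symm.le.trans ?_
  exact mul_le_mul_of_nonneg_left (h1.trans h2) (by positivity)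

lemma ae_abs_le_toReal_linftyNorm {N : ℕ} {f : Space N → ℝ} {A : Set (Space N)}
    (hA : MeasurableSet A) (hf : linftyNorm f A < ∞) :
    ∀ᵐ x, x ∈ A → |f x| ≤ (linftyNorm f A).toReal := by
  rw [← ae_restrict_iff' hA]
  have h1 : linftyNorm f A = eLpNormEssSup f (volume.restrict A) := eLpNorm_exponent_top
  filter_upwards [enorm_ae_le_eLpNormEssSup f (volume.restrict A)] with x hx
  rw [← h1, Real.enorm_eq_ofReal_abs] at hx
  exact (ENNReal.ofReal_le_iff_le_toReal hf.ne).1 hx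

/-! ### The weighted estimate. -/

theorem ae_le_mul_weight {N : ℕ} (hN : 1 ≤ N) {s : ℝ} (hs : 0 < s) (hs' : s < 1)
    {μ : ℝ} (hμ : (N : ℝ) / 2 < μ) (hμ' : μ < N + 2 * s) {R : ℝ} (hR : 0 < R)
    {m : ℝ} (hm : 0 < m) :
    ∃ M : ℝ, 0 < M ∧ ∀ {k : ℕ} (q : Fin k → Space N) {W u f g : Space N → ℝ},
      (∀ x, x ∉ ballUnion R q → m ≤ W x) → IsFracLaplacian s u f →
      (∀ᵐ x, f x + W x * u x = g x) → ∀ {A D : ℝ}, 0 ≤ A → 0 ≤ D →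
      (∀ᵐ x, x ∈ ballUnion R q → u x ≤ A) → (∀ᵐ x, g x ≤ D * weight μ q x) →
      ∀ᵐ x, u x ≤ M * (A * (1 + R) ^ μ + 2 / m * D) * weight μ q x := by
  have hμ0 : 0 < μ := lt_of_le_of_lt (by positivity) hμ
  obtain ⟨c, hc0, hc⟩ := exists_integral_cosSymbol_eq hN hs hs'
  obtain ⟨C, hC0, hC⟩ := exists_lintegral_profile_smul_second_difference_le hN hs hs' hμ0 hμ'
  set t : ℝ := c * (m / 2) / C with ht
  have ht0 : 0 < t := by positivity
  -- The power solves `C δ^{2s} = c m/2`; the cap at `1` is needed to compare `barrier` with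
  -- `weight`.
  set δ : ℝ := min 1 (t ^ (1 / (2 * s))) with hδdef
  have hδ : 0 < δ := lt_min one_pos (by positivity)
  have hδ' : δ ≤ 1 := min_le_left _ _
  have hδt : C * δ ^ (2 * s) ≤ c * (m / 2) := by
    have h1 : δ ^ (2 * s) ≤ (t ^ (1 / (2 * s))) ^ (2 * s) :=
      Real.rpow_le_rpow hδ.le (min_le_right _ _) (by positivity)
    rw [← Real.rpow_mul ht0.le, one_div_mul_cancel (by positivity), Real.rpow_one, ht,
      le_div_iff₀ hC0] at h1
    linarith
  refine ⟨(δ / 2) ^ (-μ), by positivity, ?_⟩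
  intro k q W u f g hW hf heq A D hA hD hu hg
  -- The first term puts `Kψ` above `A` on the balls; the second makes `Dρ ≤ (m/2)Kψ`.
  set K := A * (1 + R) ^ μ + 2 / m * D with hK
  have hK0 : 0 ≤ K := by positivity
  have hbar : IsBarrier s (c * (m / 2)) (barrier μ δ q) :=
    isBarrier_barrier q (by positivity) fun x => (hC δ hδ x).trans
      (ENNReal.ofReal_le_ofReal (mul_le_mul_of_nonneg_right hδt (profile_pos _ _).le))
  have key : ∀ᵐ x, u x ≤ K * barrier μ δ q x := by
    refine ae_le_mul_barrier hN hs hs' hc0 hc hm (continuous_barrier μ δ q)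
      (barrier_nonneg μ δ q) (memLp_barrier hμ0 hμ hδ hδ' q) hbar hf hK0 ?_
    filter_upwards [heq, hu, hg] with x e1 e2 e3 hx
    have hwb := weight_le_barrier hμ0 hδ hδ' q x
    have hb0 := barrier_nonneg μ δ q x
    have hux : 0 ≤ u x := (mul_nonneg hK0 hb0).trans hx.le
    have hxB : x ∉ ballUnion R q := by
      intro hxB
      have h1 := one_le_mul_weight_of_mem_ballUnion hμ0 hR hxB
      have h2 : A * 1 ≤ A * ((1 + R) ^ μ * weight μ q x) := by gcongr
      have h3 : A * (1 + R) ^ μ * weight μ q x ≤ K * barrier μ δ q x := by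
        refine mul_le_mul ?_ hwb ?_ hK0
        · rw [hK]; exact le_add_of_nonneg_right (by positivity)
        · exact nonneg_of_mul_nonneg_right (zero_le_one.trans h1) (by positivity)
      linarith [e2 hxB]
    have h4 : m * u x ≤ W x * u x := mul_le_mul_of_nonneg_right (hW x hxB) hux
    have h5 : D ≤ m / 2 * K := by
      have : m / 2 * K = m / 2 * (A * (1 + R) ^ μ) + D := by rw [hK]; field_simp
      rw [this]; exact le_add_of_nonneg_left (by positivity)
    have h6 : D * weight μ q x ≤ m / 2 * K * barrier μ δ q x :=
      (mul_le_mul_of_nonneg_left hwb hD).trans (mul_le_mul_of_nonneg_right h5 hb0)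
    linarith
  filter_upwards [key] with x hx
  calc u x ≤ K * barrier μ δ q x := hx
    _ ≤ K * ((δ / 2) ^ (-μ) * weight μ q x) :=
        mul_le_mul_of_nonneg_left (barrier_le_weight hμ0 hδ hδ' q x) hK0
    _ = _ := by ring

end FracSchrodinger

end

theorem mainTheorem7 (N : ℕ) (hN : 1 ≤ N) (s : ℝ) (hs : 0 < s) (hs' : s < 1)
    (μ : ℝ) (hμ : (N : ℝ) / 2 < μ) (hμ' : μ < N + 2 * s)
    (R : ℝ) (hR : 0 < R) (m : ℝ) (hm : 0 < m) :
    ∃ C : ℝ, 0 < C ∧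
      ∀ (k : ℕ) (_ : 1 ≤ k) (q : Fin k → FracSchrodinger.Space N)
        (W : FracSchrodinger.Space N → ℝ) (_ : Continuous W)
        (_ : ∀ x, x ∉ FracSchrodinger.ballUnion R q → m ≤ W x)
        (φ g : FracSchrodinger.Space N → ℝ)
        (_ : FracSchrodinger.MemH (2 * s) φ) (_ : MemLp φ ∞ volume)
        (_ : FracSchrodinger.SolvesEq s W φ g)
        (_ : FracSchrodinger.linftyNorm
          (fun x => (FracSchrodinger.weight μ q x)⁻¹ * g x) Set.univ < ∞),
        FracSchrodinger.linftyNorm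
            (fun x => (FracSchrodinger.weight μ q x)⁻¹ * φ x) Set.univ ≤
          ENNReal.ofReal C *
            (FracSchrodinger.linftyNorm φ (FracSchrodinger.ballUnion R q) +
              FracSchrodinger.linftyNorm
                (fun x => (FracSchrodinger.weight μ q x)⁻¹ * g x) Set.univ) := by
  obtain ⟨M, hM, hmain⟩ := FracSchrodinger.ae_le_mul_weight hN hs hs' hμ hμ' hR hm
  refine ⟨M * ((1 + R) ^ μ + 2 / m), by positivity, ?_⟩
  intro k hk q W _ hW φ g _ hφtop ⟨f, hf, heq⟩ hg
  have hB : MeasurableSet (FracSchrodinger.ballUnion R q) :=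
    (isOpen_iUnion fun j => Metric.isOpen_ball).measurableSet
  have hφB : FracSchrodinger.linftyNorm φ (FracSchrodinger.ballUnion R q) < ∞ :=
    (hφtop.mono_measure Measure.restrict_le_self).2
  have hA := FracSchrodinger.ae_abs_le_toReal_linftyNorm hB hφB
  have hD := FracSchrodinger.ae_abs_le_toReal_linftyNorm MeasurableSet.univ hg
  rw [← ENNReal.ofReal_toReal hφB.ne, ← ENNReal.ofReal_toReal hg.ne]
  set A := (FracSchrodinger.linftyNorm φ (FracSchrodinger.ballUnion R q)).toReal
  set D := (FracSchrodinger.linftyNorm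
    (fun x => (FracSchrodinger.weight μ q x)⁻¹ * g x) Set.univ).toReal
  have hA0 : 0 ≤ A := ENNReal.toReal_nonneg
  have hD0 : 0 ≤ D := ENNReal.toReal_nonneg
  have hgD : ∀ᵐ x, |g x| ≤ D * FracSchrodinger.weight μ q x := by
    filter_upwards [hD] with x hx
    have hw := FracSchrodinger.weight_pos hk μ q x
    have h1 := hx (Set.mem_univ x)
    rwa [abs_mul, abs_of_pos (inv_pos.2 hw), inv_mul_le_iff₀ hw, mul_comm] at h1
  have hup := hmain q hW hf heq hA0 hD0
    (hA.mono fun x hx hxB => (abs_le.1 (hx hxB)).2) (hgD.mono fun x hx => (abs_le.1 hx).2)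
  -- The equation is linear, so the one-sided bound for `-φ` is the lower bound for `φ`.
  have hlow := hmain q (u := -φ) (f := -f) (g := -g) hW hf.neg
    (heq.mono fun x hx => by simp only [Pi.neg_apply]; linarith) hA0 hD0
    (hA.mono fun x hx hxB => by have := (abs_le.1 (hx hxB)).1; simp only [Pi.neg_apply]; linarith)
    (hgD.mono fun x hx => by have := (abs_le.1 hx).1; simp only [Pi.neg_apply]; linarith)
  rw [← ENNReal.ofReal_add hA0 hD0, ← ENNReal.ofReal_mul (by positivity),
    FracSchrodinger.linftyNorm, Measure.restrict_univ, eLpNorm_exponent_top]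
  refine eLpNormEssSup_le_of_ae_bound ?_
  filter_upwards [hup, hlow] with x h1 h2
  have hw := FracSchrodinger.weight_pos hk μ q x
  rw [Real.norm_eq_abs, abs_mul, abs_of_pos (inv_pos.2 hw), inv_mul_le_iff₀ hw]
  have h3 : |φ x| ≤ M * (A * (1 + R) ^ μ + 2 / m * D) * FracSchrodinger.weight μ q x :=
    abs_le.2 ⟨by simp only [Pi.neg_apply] at h2; linarith, h1⟩
  refine h3.trans ?_
  rw [mul_comm]
  refine mul_le_mul_of_nonneg_left ?_ hw.le
  rw [mul_assoc]
  refine mul_le_mul_of_nonneg_left ?_ hM.le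
  have h4 : 0 ≤ (1 + R) ^ μ * D := by positivity
  have h5 : 0 ≤ 2 / m * A := by positivity
  linarith
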